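/- Let $K \ge 1$, let $h_2,\dots,h_K \in \mathbb{R}$ and let $P_1,\dots,P_K \ge 0$. The Gaussian many-to-one channel in standard form has $K$ transmitters and $K$ receivers and the input-output relations $$y_1 = x_1 + \sum_{j=2}^K h_j x_j + n_1, \qquad y_i = x_i + n_i \quad (i = 2,\dots,K),$$ where the noise is $\mathcal{N}(0,1)$, i.i.d. over channel uses and independent of the inputs, and every codeword $\mathbf{x}_i^n$ of transmitter $i$ satisfies $\frac1n\|\mathbf{x}_i^n\|_2^2 \le P_i$. In the $K \times K$ many-to-one X channel (XC) there are $2K-1$ independent, uniformly distributed messages $W_{11}$ and $W_{jj}, W_{1j}$ ($j = 2,\dots,K$), where a message $W_{ij}$ of rate $R_{ij} \ge 0$ takes $\lceil 2^{nR_{ij}}\rceil$ values at block length $n$. Transmitter $1$ encodes $W_{11}$, transmitter $j \ge 2$ encodes $(W_{jj}, W_{1j})$, receiver $1$ decodes $(W_{11}, W_{12},\dots,W_{1K})$, and receiver $j \ge 2$ decodes $W_{jj}$. In the $K$-user many-to-one interference channel (IC) with the same $h_j$ and $P_i$, the cross messages $W_{1j}$, $j \ge 2$, are absent: transmitter $i$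 encodes $W_{ii}$ and receiver $i$ decodes $W_{ii}$, for all $i$. For each of the two channels, a rate vector is achievable if there is a sequence of codes, one for each block length $n$, whose average error probability at every receiver tends to $0$ as $n \to \infty$; the capacity region is the closure of the set of achievable rate vectors; and the sum-rate capacity, $S_{\mathrm{XC}}$ or $S_{\mathrm{IC}}$, is the maximum over the capacity region of the sum of all rates. If $h_i^2 \le 1$ for all $i = 2,\dots,K$, then the many-to-one XC can be operated as a $K$-user many-to-one IC without loss of sum-rate: both maxima exist, and $S_{\mathrm{XC}} = S_{\mathrm{IC}}$. -/

import Mathlib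

open MeasureTheory ProbabilityTheory Filter Topology

noncomputable section

namespace ManyToOne

/-- The users `2, …, K`. Users are indexed by `Fin K`, and `0 : Fin K` is user 1. -/
abbrev Others (K : ℕ) [NeZero K] : Type := {j : Fin K // j ≠ 0}

/-- The noiseless part of the output block at each receiver of the many-to-one channel in standard
form: receiver 1 sees `x₁ + ∑_{j ≥ 2} h_j x_j`, and receiver `i ≥ 2` sees `x_i`. -/
def signal {K n : ℕ} [NeZero K] (h : Others K → ℝ) (x : Fin K → Fin n → ℝ) (i : Fin K) :
    Fin n → ℝ :=
  fun t => if i = 0 then x 0 t + ∑ j : Others K, h j * x j t else x i t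

/-- The law of the noise block at a receiver: `n` i.i.d. standard Gaussian random variables. -/
def noise (n : ℕ) : Measure (Fin n → ℝ) :=
  Measure.pi fun _ => gaussianReal 0 1

/-- The average power constraint `(1/n) ‖x‖₂² ≤ P` on a codeword of length `n`. -/
def PowerConstraint {n : ℕ} (P : ℝ) (x : Fin n → ℝ) : Prop :=
  (∑ t, x t ^ 2) / n ≤ P

/-- The number of messages, `2 ^ (n R)` rounded up, at rate `R` (in bits) and block length `n`. -/
def numMessages (n : ℕ) (R : ℝ) : ℕ :=
  ⌈(2 : ℝ) ^ ((n : ℝ) * R)⌉₊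

/-! ### The many-to-one X channel -/

/-- A code of block length `n` for the many-to-one X channel. The message `W_ii` takes `M i` values
and the cross message `W_1j`, `j ≥ 2`, takes `L j` values. Transmitter 1 encodes `W_11`,
transmitter `j ≥ 2` encodes `(W_jj, W_1j)`, receiver 1 decodes `(W_11, W_12, …, W_1K)`, and
receiver `j ≥ 2` decodes `W_jj`. -/
structure XCode {K : ℕ} [NeZero K] (P : Fin K → ℝ) (n : ℕ) (M : Fin K → ℕ)
    (L : Others K → ℕ) where
  enc₁ : Fin (M 0) → Fin n → ℝ
  enc : ∀ j : Others K, Fin (M j) × Fin (L j) → Fin n → ℝ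
  power₁ : ∀ w, PowerConstraint (P 0) (enc₁ w)
  power : ∀ (j : Others K) w, PowerConstraint (P j) (enc j w)
  dec₁ : (Fin n → ℝ) → Fin (M 0) × (∀ j : Others K, Fin (L j))
  dec : ∀ j : Others K, (Fin n → ℝ) → Fin (M j)
  measurable_dec₁ : Measurable dec₁
  measurable_dec : ∀ j, Measurable (dec j)

namespace XCode

variable {K : ℕ} [NeZero K] {P : Fin K → ℝ} {n : ℕ} {M : Fin K → ℕ} {L : Others K → ℕ}

/-- The transmitted codewords for the direct messages `w.1` and the cross messages `w.2`. -/
def codeword (c : XCode P n M L) (w : (∀ i, Fin (M i)) × (∀ j, Fin (L j))) :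
    Fin K → Fin n → ℝ :=
  fun i => if hi : i = 0 then c.enc₁ (w.1 0) else c.enc ⟨i, hi⟩ (w.1 i, w.2 ⟨i, hi⟩)

/-- Average error probability at receiver 1, for independent uniform messages. -/
def error₁ (c : XCode P n M L) (h : Others K → ℝ) : ℝ :=
  (∑ w : (∀ i, Fin (M i)) × (∀ j, Fin (L j)),
      (noise n).real {z | c.dec₁ (signal h (c.codeword w) 0 + z) ≠ (w.1 0, w.2)}) /
    Fintype.card ((∀ i, Fin (M i)) × (∀ j, Fin (L j)))

/-- Average error probability at receiver `k ≥ 2`, for independent uniform messages. -/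
def error (c : XCode P n M L) (h : Others K → ℝ) (k : Others K) : ℝ :=
  (∑ w : (∀ i, Fin (M i)) × (∀ j, Fin (L j)),
      (noise n).real {z | c.dec k (signal h (c.codeword w) k + z) ≠ w.1 k}) /
    Fintype.card ((∀ i, Fin (M i)) × (∀ j, Fin (L j)))

end XCode

/-- A rate vector of the X channel: `R.1 i` is `R_ii`, and `R.2 j` is `R_1j`. -/
abbrev XRates (K : ℕ) [NeZero K] : Type := (Fin K → ℝ) × (Others K → ℝ)

/-- Achievability of a (nonnegative) rate vector for the many-to-one X channel. -/
def XAchievable {K : ℕ} [NeZero K] (h : Others K → ℝ) (P : Fin K → ℝ) (R : XRates K) : Prop :=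
  (∀ i, 0 ≤ R.1 i) ∧ (∀ j, 0 ≤ R.2 j) ∧
    ∃ c : ∀ n : ℕ, XCode P n (fun i => numMessages n (R.1 i)) (fun j => numMessages n (R.2 j)),
      Tendsto (fun n => (c n).error₁ h) atTop (𝓝 0) ∧
      ∀ k, Tendsto (fun n => (c n).error h k) atTop (𝓝 0)

/-- The capacity region of the many-to-one X channel. -/
def xCapacityRegion {K : ℕ} [NeZero K] (h : Others K → ℝ) (P : Fin K → ℝ) : Set (XRates K) :=
  closure {R | XAchievable h P R}

/-- The sum-rates `R_11 + ∑_{i ≥ 2} (R_ii + R_1i)` over the capacity region of the X channel. -/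
def xSumRates {K : ℕ} [NeZero K] (h : Others K → ℝ) (P : Fin K → ℝ) : Set ℝ :=
  (fun R : XRates K => R.1 0 + ∑ i : Others K, (R.1 i + R.2 i)) '' xCapacityRegion h P

/-- The sum-rate capacity of the many-to-one X channel. -/
def xSumCapacity {K : ℕ} [NeZero K] (h : Others K → ℝ) (P : Fin K → ℝ) : ℝ :=
  sSup (xSumRates h P)

/-! ### The many-to-one interference channel (no cross messages) -/

/-- A code of block length `n` for the many-to-one interference channel: transmitter `i` encodes
`W_ii`, which takes `M i` values, and receiver `i` decodes it. -/
structure ICode {K : ℕ} (P : Fin K → ℝ) (n : ℕ) (M : Fin K → ℕ) where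
  enc : ∀ i, Fin (M i) → Fin n → ℝ
  power : ∀ i w, PowerConstraint (P i) (enc i w)
  dec : ∀ i, (Fin n → ℝ) → Fin (M i)
  measurable_dec : ∀ i, Measurable (dec i)

/-- Average error probability at receiver `k`, for independent uniform messages. -/
def ICode.error {K : ℕ} [NeZero K] {P : Fin K → ℝ} {n : ℕ} {M : Fin K → ℕ}
    (c : ICode P n M) (h : Others K → ℝ) (k : Fin K) : ℝ :=
  (∑ w : ∀ i, Fin (M i),
      (noise n).real {z | c.dec k (signal h (fun i => c.enc i (w i)) k + z) ≠ w k}) /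
    Fintype.card (∀ i, Fin (M i))

/-- Achievability of a (nonnegative) rate vector for the many-to-one interference channel. -/
def IAchievable {K : ℕ} [NeZero K] (h : Others K → ℝ) (P : Fin K → ℝ) (R : Fin K → ℝ) : Prop :=
  (∀ i, 0 ≤ R i) ∧
    ∃ c : ∀ n : ℕ, ICode P n (fun i => numMessages n (R i)),
      ∀ k, Tendsto (fun n => (c n).error h k) atTop (𝓝 0)

/-- The capacity region of the many-to-one interference channel. -/
def iCapacityRegion {K : ℕ} [NeZero K] (h : Others K → ℝ) (P : Fin K → ℝ) : Set (Fin K → ℝ) :=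
  closure {R | IAchievable h P R}

/-- The sum-rates over the capacity region of the interference channel. -/
def iSumRates {K : ℕ} [NeZero K] (h : Others K → ℝ) (P : Fin K → ℝ) : Set ℝ :=
  (fun R : Fin K → ℝ => ∑ i, R i) '' iCapacityRegion h P

/-- The sum-rate capacity of the many-to-one interference channel. -/
def iSumCapacity {K : ℕ} [NeZero K] (h : Others K → ℝ) (P : Fin K → ℝ) : ℝ :=
  sSup (iSumRates h P)

end ManyToOne

end

noncomputable section

namespace ManyToOne

/-! When `h j ^ 2 ≤ 1`, receiver `j` sees its transmitter at least as cleanly as receiver 1 does. It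
scales its output by `h j`, tops the noise up to variance 1 and adds the contribution of a fixed
choice of the other messages; `dec₁` then recovers the cross message (`XCode.exists_cross_decoder`).
So receiver `j` can decode the pair `(W_jj, W_1j)`, and the pair can be treated as a single direct
message of rate `R_jj + R_1j` (`XCode.exists_iCode`, `XAchievable.merge`). Passing to the merged
message set costs only a factor in the error that does not depend on `n`. Conversely, a cross rate 0
means a one-element message set, so an interference code is an X code (`IAchievable.xAchievable`).
Hence the two sets of sum-rates coincide. The maxima exist because the interference region is
compact: a crude change of measure bounds the rates (`IAchievable.rate_le`). -/

/-! ### Gaussian noise: mixing and domination -/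

instance isProbabilityMeasure_noise (n : ℕ) : IsProbabilityMeasure (noise n) := by
  unfold noise; infer_instance

/-- Attenuating standard Gaussian noise by `a` and adding independent Gaussian noise of variance
`1 - a ^ 2` gives standard Gaussian noise. -/
lemma gaussianReal_prod_map_mix {a : ℝ} (ha : a ^ 2 ≤ 1) :
    ((gaussianReal 0 1).prod (gaussianReal 0 1)).map
      (fun p : ℝ × ℝ => a * p.1 + √(1 - a ^ 2) * p.2) = gaussianReal 0 1 := by
  have hmap : (fun p : ℝ × ℝ => a * p.1 + √(1 - a ^ 2) * p.2) =
      (fun p : ℝ × ℝ => p.1 + p.2) ∘ Prod.map (a * ·) (√(1 - a ^ 2) * ·) := rfl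
  rw [hmap, ← Measure.map_map (by fun_prop) (by fun_prop),
    ← Measure.map_prod_map _ _ (by fun_prop) (by fun_prop), gaussianReal_map_const_mul,
    gaussianReal_map_const_mul]
  change Measure.conv _ _ = _
  rw [gaussianReal_conv_gaussianReal, gaussianReal_ext_iff]
  refine ⟨by simp, ?_⟩
  ext
  simp only [mul_one, NNReal.coe_add, NNReal.coe_mk, NNReal.coe_one]
  rw [Real.sq_sqrt (by linarith)]
  ring

lemma measurePreserving_noise_mix {a : ℝ} (ha : a ^ 2 ≤ 1) (n : ℕ) :
    MeasurePreserving
      (fun p : (Fin n → ℝ) × (Fin n → ℝ) => fun t => a * p.1 t + √(1 - a ^ 2) * p.2 t)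
      ((noise n).prod (noise n)) (noise n) := by
  have h₁ := (measurePreserving_arrowProdEquivProdArrow ℝ ℝ (Fin n)
    (fun _ => gaussianReal 0 1) (fun _ => gaussianReal 0 1)).symm
  have h₂ := measurePreserving_pi (fun _ : Fin n => (gaussianReal 0 1).prod (gaussianReal 0 1))
    (fun _ : Fin n => gaussianReal 0 1)
    (f := fun _ p => a * p.1 + √(1 - a ^ 2) * p.2)
    (fun _ => ⟨by fun_prop, gaussianReal_prod_map_mix ha⟩)
  exact h₂.comp h₁

/-- `OuterMeasure.pi` is the largest outer measure bounded on boxes by the product of the factors,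
so a comparison on boxes suffices. -/
lemma pi_le_pi {ι : Type*} [Fintype ι] {α : ι → Type*} [∀ i, MeasurableSpace (α i)]
    {μ ν : ∀ i, Measure (α i)} [∀ i, SigmaFinite (μ i)] (hle : ∀ i, μ i ≤ ν i) :
    Measure.pi μ ≤ Measure.pi ν := by
  refine Measure.le_iff.2 fun A hA => ?_
  conv_rhs => rw [Measure.pi, toMeasure_apply _ _ hA]
  have key : (Measure.pi μ).toOuterMeasure ≤
      OuterMeasure.pi fun i => (ν i).toOuterMeasure := by
    rw [OuterMeasure.le_pi]
    intro s _
    change Measure.pi μ _ ≤ _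
    rw [Measure.pi_pi]
    exact Finset.prod_le_prod' fun i _ => hle i _
  exact key A

lemma pi_smul_measure {ι : Type*} [Fintype ι] {α : ι → Type*} [∀ i, MeasurableSpace (α i)]
    (ν : ∀ i, Measure (α i)) [∀ i, SigmaFinite (ν i)] (c : ι → NNReal) :
    Measure.pi (fun i => c i • ν i) = (∏ i, c i) • Measure.pi ν := by
  refine (Measure.pi_eq fun s _ => ?_)
  simp only [Measure.smul_apply, Measure.pi_pi, Finset.prod_mul_distrib, ENNReal.smul_def,
    smul_eq_mul, ENNReal.ofNNReal_finsetProd]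

/-- The ratio of the densities is `√2 * exp (-(y - m) ^ 2 / 2 + y ^ 2 / 4)`, maximal at `y = 2 * m`.
The larger variance is what keeps it bounded. -/
lemma gaussianReal_le_smul_gaussianReal (m : ℝ) :
    gaussianReal m 1 ≤ (√2 * Real.exp (m ^ 2 / 2)).toNNReal • gaussianReal 0 2 := by
  refine Measure.le_iff.2 fun A hA => ?_
  rw [Measure.smul_apply, gaussianReal_apply _ one_ne_zero, gaussianReal_apply _ two_ne_zero,
    ENNReal.smul_def, smul_eq_mul, ← lintegral_const_mul _ (measurable_gaussianPDF _ _)]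
  refine lintegral_mono fun y => ?_
  rw [gaussianPDF_def, gaussianPDF_def, ENNReal.ofNNReal_toNNReal,
    ← ENNReal.ofReal_mul (by positivity)]
  refine ENNReal.ofReal_le_ofReal ?_
  rw [gaussianPDFReal, gaussianPDFReal]
  have hsqrt : √(2 * Real.pi * (2 : NNReal)) = √2 * √(2 * Real.pi * (1 : NNReal)) := by
    rw [← Real.sqrt_mul (by norm_num)]
    congr 1
    simp only [NNReal.coe_ofNat, NNReal.coe_one]
    ring
  rw [hsqrt]
  have h2 : √2 ≠ 0 := by positivity
  have h2pi : √(2 * Real.pi * (1 : NNReal)) ≠ 0 := by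
    simp only [NNReal.coe_one]; positivity
  have hexp : Real.exp (-(y - m) ^ 2 / (2 * (1 : NNReal))) ≤
      Real.exp (m ^ 2 / 2) * Real.exp (-(y - 0) ^ 2 / (2 * (2 : NNReal))) := by
    rw [← Real.exp_add]
    refine Real.exp_le_exp.2 ?_
    simp only [NNReal.coe_ofNat, NNReal.coe_one]
    nlinarith [sq_nonneg (y - 2 * m)]
  calc _ ≤ (√(2 * Real.pi * (1 : NNReal)))⁻¹ *
        (Real.exp (m ^ 2 / 2) * Real.exp (-(y - 0) ^ 2 / (2 * (2 : NNReal)))) := by gcongr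
    _ = _ := by field_simp

/-- The law of a noisy block is dominated by a wider Gaussian law, up to a factor that is
exponential in the block length and in the energy of the block. -/
lemma noise_real_add_le {n : ℕ} (s : Fin n → ℝ) {A : Set (Fin n → ℝ)} (hA : MeasurableSet A) :
    (noise n).real {z | s + z ∈ A} ≤
      √2 ^ n * Real.exp ((∑ t, s t ^ 2) / 2) *
        (Measure.pi fun _ : Fin n => gaussianReal 0 2).real A := by
  have hmap : (noise n).map (s + ·) = Measure.pi fun t => gaussianReal (s t) 1 := by
    refine (measurePreserving_pi (fun _ : Fin n => gaussianReal 0 1)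
      (fun t => gaussianReal (s t) 1) (f := fun t x => s t + x) fun t => ⟨by fun_prop, ?_⟩).map_eq
    rw [gaussianReal_map_const_add, zero_add]
  have hle : (noise n).map (s + ·) ≤ _ :=
    hmap.trans_le (pi_le_pi fun t => gaussianReal_le_smul_gaussianReal (s t))
  rw [pi_smul_measure] at hle
  have hA' : (noise n) {z | s + z ∈ A} ≤ _ :=
    (Measure.map_apply (by fun_prop) hA).symm.trans_le (hle A)
  rw [measureReal_def]
  refine (ENNReal.toReal_mono (by finiteness) hA').trans_eq ?_
  rw [Measure.smul_apply, ENNReal.smul_def, smul_eq_mul, ENNReal.toReal_mul, ENNReal.coe_toReal,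
    NNReal.coe_prod, measureReal_def]
  congr 1
  rw [Finset.prod_congr rfl fun t _ => Real.coe_toNNReal _ (by positivity),
    Finset.prod_mul_distrib, ← Real.exp_sum, Finset.sum_div]
  simp

/-! ### Message counts -/

lemma one_le_numMessages (n : ℕ) (R : ℝ) : 1 ≤ numMessages n R :=
  Nat.ceil_pos.2 (by positivity)

lemma rpow_le_numMessages (n : ℕ) (R : ℝ) : (2 : ℝ) ^ ((n : ℝ) * R) ≤ numMessages n R :=
  Nat.le_ceil _

lemma numMessages_le_two_mul (n : ℕ) {R : ℝ} (hR : 0 ≤ R) :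
    (numMessages n R : ℝ) ≤ 2 * (2 : ℝ) ^ ((n : ℝ) * R) := by
  have h1 : (1 : ℝ) ≤ (2 : ℝ) ^ ((n : ℝ) * R) :=
    Real.one_le_rpow (by norm_num) (by positivity)
  have := Nat.ceil_lt_add_one (show (0 : ℝ) ≤ (2 : ℝ) ^ ((n : ℝ) * R) by positivity)
  unfold numMessages
  linarith

lemma numMessages_zero (n : ℕ) : numMessages n 0 = 1 := by
  simp [numMessages]

lemma numMessages_add_le (n : ℕ) (R S : ℝ) :
    numMessages n (R + S) ≤ numMessages n R * numMessages n S := by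
  rw [numMessages, Nat.ceil_le, mul_add, Real.rpow_add (by norm_num), Nat.cast_mul]
  exact mul_le_mul (rpow_le_numMessages n R) (rpow_le_numMessages n S) (by positivity)
    (by positivity)

lemma measurable_noise_set {n : ℕ} {β : Type*} [MeasurableSpace β] [MeasurableSingletonClass β]
    {f : (Fin n → ℝ) → β} (hf : Measurable f) (s : Fin n → ℝ) (b : β) :
    MeasurableSet {z | f (s + z) ≠ b} :=
  ((hf.comp (measurable_const_add s)) (measurableSet_singleton b)).compl

/-! ### The interference channel: rates are bounded -/

lemma sum_apply_mul_card {ι : Type*} [Fintype ι] [DecidableEq ι] {α : ι → Type*}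
    [∀ i, Fintype (α i)] (i : ι) (F : α i → ℝ) :
    (∑ w : ∀ k, α k, F (w i)) * Fintype.card (α i) =
      Fintype.card (∀ k, α k) * ∑ m, F m := by
  -- The involution that exchanges coordinate `i` with the spare entry.
  let e : (∀ k, α k) × α i ≃ (∀ k, α k) × α i :=
    { toFun := fun p => (Function.update p.1 i p.2, p.1 i)
      invFun := fun p => (Function.update p.1 i p.2, p.1 i)
      left_inv := fun p => by simp
      right_inv := fun p => by simp }
  have := e.sum_comp fun p => F p.2
  rw [Fintype.sum_prod_type, Fintype.sum_prod_type] at this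
  simp only [e, Equiv.coe_fn_mk, Finset.sum_const, Finset.card_univ, nsmul_eq_mul] at this
  rw [← this, ← Finset.mul_sum, mul_comm]

/-- Only linearity in `n` matters; the crude constant, from Cauchy–Schwarz, serves all receivers at
once. -/
lemma sum_sq_signal_le {K n : ℕ} [NeZero K] {h : Others K → ℝ} {P : Fin K → ℝ}
    (hP : ∀ i, 0 ≤ P i) (hh : ∀ i, h i ^ 2 ≤ 1) {x : Fin K → Fin n → ℝ}
    (hx : ∀ i, PowerConstraint (P i) (x i)) (i : Fin K) :
    ∑ t, signal h x i t ^ 2 ≤ n * (2 * K * ∑ i, P i + 2 * P 0) := by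
  have hx' : ∀ i, ∑ t, x i t ^ 2 ≤ n * P i := fun i => by
    -- At `n = 0` the power constraint divides by zero and carries no information, but the sum is
    -- empty.
    rcases Nat.eq_zero_or_pos n with rfl | hn
    · simp
    · have := hx i
      rw [PowerConstraint, div_le_iff₀ (by positivity)] at this
      linarith
  have hK : (1 : ℝ) ≤ K := by exact_mod_cast NeZero.one_le
  have hsum : ∀ i, P i ≤ ∑ i, P i := fun i =>
    Finset.single_le_sum (fun i _ => hP i) (Finset.mem_univ i)
  have h0 : 0 ≤ ∑ i, P i := Finset.sum_nonneg fun i _ => hP i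
  by_cases hi : i = 0
  · subst hi
    have hpt : ∀ t, signal h x 0 t ^ 2 ≤ 2 * x 0 t ^ 2 + 2 * (K * ∑ i, x i t ^ 2) := fun t => by
      have h1 : (∑ j : Others K, h j * x j t) ^ 2 ≤ K * ∑ i, x i t ^ 2 := by
        calc (∑ j : Others K, h j * x j t) ^ 2
            ≤ (∑ j : Others K, h j ^ 2) * ∑ j : Others K, x j t ^ 2 :=
              Finset.sum_mul_sq_le_sq_mul_sq _ _ _
          _ ≤ K * ∑ i, x i t ^ 2 := by
              refine mul_le_mul ?_ ?_ (Finset.sum_nonneg fun _ _ => sq_nonneg _) (by positivity)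
              · calc ∑ j : Others K, h j ^ 2 ≤ ∑ _j : Others K, (1 : ℝ) :=
                      Finset.sum_le_sum fun j _ => hh j
                  _ = Fintype.card (Others K) := by simp
                  _ ≤ K := by
                    exact_mod_cast (Fintype.card_subtype_le _).trans_eq (Fintype.card_fin K)
              · rw [← Finset.sum_subtype (Finset.univ.filter fun j : Fin K => j ≠ 0) (by simp)
                  fun j => x j t ^ 2]
                exact Finset.sum_le_sum_of_subset_of_nonneg (Finset.subset_univ _)
                  fun _ _ _ => sq_nonneg _
      have h2 : signal h x 0 t = x 0 t + ∑ j : Others K, h j * x j t := by simp [signal]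
      rw [h2]
      nlinarith [sq_nonneg (x 0 t - ∑ j : Others K, h j * x j t)]
    calc ∑ t, signal h x 0 t ^ 2 ≤ ∑ t, (2 * x 0 t ^ 2 + 2 * (K * ∑ i, x i t ^ 2)) :=
          Finset.sum_le_sum fun t _ => hpt t
      _ = 2 * ∑ t, x 0 t ^ 2 + 2 * (K * ∑ i, ∑ t, x i t ^ 2) := by
          rw [Finset.sum_add_distrib, ← Finset.mul_sum, ← Finset.mul_sum, ← Finset.mul_sum,
            Finset.sum_comm]
      _ ≤ 2 * (n * P 0) + 2 * (K * ∑ i, n * P i) := by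
          gcongr
          · exact hx' 0
          · exact hx' _
      _ = _ := by rw [← Finset.mul_sum]; ring
  · have h2 : ∀ t, signal h x i t = x i t := fun t => by simp [signal, hi]
    simp only [h2]
    refine (hx' i).trans ?_
    gcongr
    nlinarith [hsum i, hP 0]

/-- A bound on the number of messages of a user in terms of the error probability. -/
lemma ICode.one_sub_error_le {K n : ℕ} [NeZero K] {P : Fin K → ℝ} (hP : ∀ i, 0 ≤ P i)
    {M : Fin K → ℕ} (hM : ∀ i, 0 < M i) (c : ICode P n M) {h : Others K → ℝ}
    (hh : ∀ i, h i ^ 2 ≤ 1) (i : Fin K) :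
    1 - c.error h i ≤ (√2 * Real.exp (K * ∑ i, P i + P 0)) ^ n / M i := by
  have : ∀ i, NeZero (M i) := fun i => ⟨(hM i).ne'⟩
  set Q := Measure.pi fun _ : Fin n => gaussianReal 0 2
  -- The factor in `noise_real_add_le`, with half the energy bound of `sum_sq_signal_le` in the
  -- exponent.
  set C := (√2 * Real.exp (K * ∑ i, P i + P 0)) ^ n
  have hC : 0 ≤ C := by positivity
  have hW : (0 : ℝ) < Fintype.card (∀ i, Fin (M i)) := by exact_mod_cast Fintype.card_pos
  have hMi : (0 : ℝ) < M i := by exact_mod_cast hM i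
  have hset : ∀ m, MeasurableSet {y | c.dec i y = m} := fun m =>
    c.measurable_dec i (measurableSet_singleton m)
  have key : ∀ w : ∀ i, Fin (M i),
      1 - (noise n).real {z | c.dec i (signal h (fun i => c.enc i (w i)) i + z) ≠ w i} ≤
        C * Q.real {y | c.dec i y = w i} := fun w => by
    have := probReal_compl_eq_one_sub (μ := noise n)
      (measurable_noise_set (c.measurable_dec i) (signal h (fun i => c.enc i (w i)) i) (w i))
    rw [← this]
    have hb := noise_real_add_le (signal h (fun i => c.enc i (w i)) i) (hset (w i))
    refine (le_of_eq ?_).trans (hb.trans ?_)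
    · congr 1; ext z; simp
    · gcongr
      simp only [C]
      rw [mul_pow, ← Real.exp_nat_mul]
      gcongr
      have := sum_sq_signal_le hP hh (fun i => c.power i (w i)) i
      linarith
  -- The decoding regions partition the output space and `Q` does not depend on the message, so the
  -- average success probability is at most `C / M i`.
  have hsumQ : ∑ m, Q.real {y | c.dec i y = m} = 1 := by
    have := sum_measureReal_preimage_singleton (μ := Q) (f := c.dec i) Finset.univ
      (fun m _ => hset m)
    simpa [Set.preimage] using this
  have hsum := Finset.sum_le_sum fun w (_ : w ∈ Finset.univ) => key w
  rw [Finset.sum_sub_distrib, ← Finset.mul_sum] at hsum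
  have hcard := sum_apply_mul_card (α := fun i => Fin (M i)) i
    fun m => Q.real {y | c.dec i y = m}
  rw [hsumQ, Fintype.card_fin, mul_one, ← eq_div_iff hMi.ne'] at hcard
  rw [hcard] at hsum
  rw [ICode.error, one_sub_div hW.ne', div_le_div_iff₀ hW hMi]
  simp only [Finset.sum_const, Finset.card_univ, nsmul_eq_mul, mul_one] at hsum
  calc _ ≤ C * (Fintype.card (∀ i, Fin (M i)) / M i) * M i := by gcongr
    _ = _ := by field_simp

/-- Above this rate the success probability would decay geometrically, while achievability sends it
to 1. -/
lemma IAchievable.rate_le {K : ℕ} [NeZero K] {h : Others K → ℝ} {P : Fin K → ℝ} {R : Fin K → ℝ}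
    (hR : IAchievable h P R) (hP : ∀ i, 0 ≤ P i) (hh : ∀ i, h i ^ 2 ≤ 1) (i : Fin K) :
    R i ≤ Real.logb 2 (√2 * Real.exp (K * ∑ i, P i + P 0)) := by
  obtain ⟨_, c, hc⟩ := hR
  set C := √2 * Real.exp (K * ∑ i, P i + P 0)
  have hC : 0 < C := by positivity
  by_contra! hlt
  have hCR : C < (2 : ℝ) ^ R i := (Real.logb_lt_iff_lt_rpow (by norm_num) hC).1 hlt
  have hle : ∀ n, 1 - (c n).error h i ≤ (C / (2 : ℝ) ^ R i) ^ n := fun n => by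
    refine ((c n).one_sub_error_le hP (fun i => one_le_numMessages n _) hh i).trans ?_
    rw [div_pow, ← Real.rpow_natCast ((2 : ℝ) ^ R i), ← Real.rpow_mul (by norm_num),
      mul_comm (R i)]
    exact div_le_div_of_nonneg_left (by positivity) (by positivity) (rpow_le_numMessages n _)
  have h1 : Tendsto (fun n => 1 - (c n).error h i) atTop (𝓝 (1 - 0)) :=
    (hc i).const_sub 1
  have h2 : Tendsto (fun n => (C / (2 : ℝ) ^ R i) ^ n) atTop (𝓝 0) :=
    tendsto_pow_atTop_nhds_zero_of_lt_one (by positivity) ((div_lt_one (by positivity)).2 hCR)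
  have := le_of_tendsto_of_tendsto' h1 h2 hle
  norm_num at this

lemma isCompact_iCapacityRegion {K : ℕ} [NeZero K] {h : Others K → ℝ} {P : Fin K → ℝ}
    (hP : ∀ i, 0 ≤ P i) (hh : ∀ i, h i ^ 2 ≤ 1) : IsCompact (iCapacityRegion h P) := by
  refine (isCompact_univ_pi fun _ : Fin K => isCompact_Icc (a := (0 : ℝ))
    (b := Real.logb 2 (√2 * Real.exp (K * ∑ i, P i + P 0)))).closure_of_subset ?_
  exact fun R hR i _ => ⟨hR.1 i, hR.rate_le hP hh i⟩

lemma iAchievable_zero {K : ℕ} [NeZero K] (h : Others K → ℝ) {P : Fin K → ℝ}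
    (hP : ∀ i, 0 ≤ P i) : IAchievable h P 0 := by
  have : ∀ n, Subsingleton (Fin (numMessages n 0)) := fun n => by
    rw [numMessages_zero]; infer_instance
  let d : ∀ n, Fin (numMessages n 0) := fun n => ⟨0, one_le_numMessages n 0⟩
  refine ⟨fun _ => le_rfl, fun n =>
    { enc := fun _ _ _ => 0
      power := fun i _ => by simpa [PowerConstraint] using hP i
      dec := fun _ _ => d n
      measurable_dec := fun _ => measurable_const }, fun k => ?_⟩
  refine tendsto_const_nhds.congr fun n => ?_
  rw [ICode.error, Finset.sum_eq_zero, zero_div]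
  intro w _
  have hw : d n = w k := Subsingleton.elim (α := Fin (numMessages n 0)) _ _
  have hempty : {_z : Fin n → ℝ | d n ≠ w k} = ∅ :=
    Set.eq_empty_of_forall_notMem fun z hz => hz hw
  exact (congrArg (noise n).real hempty).trans measureReal_empty

lemma isGreatest_iSumCapacity {K : ℕ} [NeZero K] {h : Others K → ℝ} {P : Fin K → ℝ}
    (hP : ∀ i, 0 ≤ P i) (hh : ∀ i, h i ^ 2 ≤ 1) :
    IsGreatest (iSumRates h P) (iSumCapacity h P) := by
  have hc : IsCompact (iSumRates h P) :=
    (isCompact_iCapacityRegion hP hh).image (by fun_prop)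
  exact hc.isGreatest_sSup ⟨_, _, subset_closure (iAchievable_zero h hP), rfl⟩

/-! ### From the X channel to the interference channel -/

namespace XCode

variable {K : ℕ} [NeZero K] {P : Fin K → ℝ} {n : ℕ} {M : Fin K → ℕ} {L : Others K → ℕ}

lemma power_codeword (c : XCode P n M L) (w : (∀ i, Fin (M i)) × (∀ j, Fin (L j))) (i : Fin K) :
    PowerConstraint (P i) (c.codeword w i) := by
  unfold codeword
  split_ifs with hi
  · subst hi; exact c.power₁ _
  · exact c.power _ _

lemma codeword_congr (c : XCode P n M L) {w w' : (∀ i, Fin (M i)) × (∀ j, Fin (L j))} {i : Fin K}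
    (h₁ : w.1 i = w'.1 i) (h₂ : ∀ hi : i ≠ 0, w.2 ⟨i, hi⟩ = w'.2 ⟨i, hi⟩) :
    c.codeword w i = c.codeword w' i := by
  unfold codeword
  split_ifs with hi
  · subst hi; rw [h₁]
  · rw [h₁, h₂ hi]

/-- The messages `u`, with those of transmitter `j` replaced by the messages in `w`. -/
def replace (j : Others K) (u w : (∀ i, Fin (M i)) × (∀ j, Fin (L j))) :
    (∀ i, Fin (M i)) × (∀ j, Fin (L j)) :=
  (Function.update u.1 j (w.1 j), Function.update u.2 j (w.2 j))

/-- The bracket is free of transmitter `j`'s messages: it is what receiver `j` adds to imitate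
receiver 1. -/
lemma signal_replace (c : XCode P n M L) (h : Others K → ℝ) (j : Others K)
    (u w : (∀ i, Fin (M i)) × (∀ j, Fin (L j))) (t : Fin n) :
    signal h (c.codeword (replace j u w)) 0 t =
      h j * c.codeword w j t + (signal h (c.codeword u) 0 t - h j * c.codeword u j t) := by
  have hj : c.codeword (replace j u w) j = c.codeword w j :=
    c.codeword_congr (by simp [replace]) (by simp [replace])
  have hne : ∀ i : Fin K, i ≠ j → c.codeword (replace j u w) i = c.codeword u i := fun i hi =>
    c.codeword_congr (by simp [replace, hi]) fun h0 => by
      have : (⟨i, h0⟩ : Others K) ≠ j := fun h => hi (congrArg Subtype.val h)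
      simp [replace, this]
  have hsum : ∀ f : Others K → ℝ, ∑ i, f i = f j + ∑ i ∈ Finset.univ.erase j, f i := fun f =>
    (Finset.add_sum_erase _ _ (Finset.mem_univ j)).symm
  have herase : ∑ i ∈ Finset.univ.erase j, h i * c.codeword (replace j u w) i t =
      ∑ i ∈ Finset.univ.erase j, h i * c.codeword u i t :=
    Finset.sum_congr rfl fun i hi => by
      rw [hne i fun he => (Finset.ne_of_mem_erase hi) (Subtype.ext he)]
  simp only [signal, if_true]
  rw [hsum, hsum, hj, hne 0 (Ne.symm j.2), herase]
  ring

/-- Exchanging the messages of transmitter `j` between `u` and `w` is an involution on pairs, so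
`replace j u w` is uniform when `u` and `w` are independent and uniform. -/
lemma sum_replace {E : Type*} [AddCommMonoid E] (j : Others K)
    (F : (∀ i, Fin (M i)) × (∀ j, Fin (L j)) → E) :
    ∑ u, ∑ w, F (replace j u w) =
      Fintype.card ((∀ i, Fin (M i)) × (∀ j, Fin (L j))) • ∑ w, F w := by
  let e : ((∀ i, Fin (M i)) × (∀ j, Fin (L j))) × ((∀ i, Fin (M i)) × (∀ j, Fin (L j))) ≃
      ((∀ i, Fin (M i)) × (∀ j, Fin (L j))) × ((∀ i, Fin (M i)) × (∀ j, Fin (L j))) :=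
    { toFun := fun p => (replace j p.1 p.2, replace j p.2 p.1)
      invFun := fun p => (replace j p.1 p.2, replace j p.2 p.1)
      left_inv := fun p => by simp [replace]
      right_inv := fun p => by simp [replace] }
  have he := e.sum_comp fun p => F p.1
  simp only [e, Equiv.coe_fn_mk] at he
  rw [← Fintype.sum_prod_type' fun u w => F (replace j u w), he,
    Fintype.sum_prod_type' fun u _ => F u]
  simp only [Finset.sum_const, Finset.card_univ, Finset.sum_nsmul]

/-- As `h_j ^ 2 ≤ 1`, receiver `j` can imitate the output of receiver 1, by adding noise and a
fixed choice `u` of the other signals, and so recover the cross message of its transmitter. -/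
lemma exists_cross_decoder (c : XCode P n M L) {h : Others K → ℝ} (hM : ∀ i, 0 < M i)
    (hL : ∀ j, 0 < L j) (j : Others K) (hj : h j ^ 2 ≤ 1) :
    ∃ d : (Fin n → ℝ) → Fin (L j), Measurable d ∧
      ∑ w, (noise n).real {z | d (c.codeword w j + z) ≠ w.2 j} ≤
        ∑ w, (noise n).real {z | c.dec₁ (signal h (c.codeword w) 0 + z) ≠ (w.1 0, w.2)} := by
  have : ∀ i, NeZero (M i) := fun i => ⟨(hM i).ne'⟩
  have : ∀ i, NeZero (L i) := fun i => ⟨(hL i).ne'⟩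
  let mix (z v : Fin n → ℝ) : Fin n → ℝ := fun t => h j * z t + √(1 - h j ^ 2) * v t
  let rest (u : (∀ i, Fin (M i)) × (∀ j, Fin (L j))) : Fin n → ℝ := fun t =>
    signal h (c.codeword u) 0 t - h j * c.codeword u j t
  -- A decoder randomized by `u` and by the extra noise `v`; both are fixed below by averaging.
  let d (u : (∀ i, Fin (M i)) × (∀ j, Fin (L j))) (v y : Fin n → ℝ) : Fin (L j) :=
    (c.dec₁ (rest u + mix y v)).2 j
  have hdec : Measurable fun y => (c.dec₁ y).2 j :=
    (measurable_pi_apply j).comp (measurable_snd.comp c.measurable_dec₁)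
  have hmix : MeasurePreserving (fun p : (Fin n → ℝ) × (Fin n → ℝ) => mix p.1 p.2)
      ((noise n).prod (noise n)) (noise n) := measurePreserving_noise_mix hj n
  have hd : ∀ u w z v, d u v (c.codeword w j + z) =
      (c.dec₁ (signal h (c.codeword (replace j u w)) 0 + mix z v)).2 j := by
    intro u w z v
    have : rest u + mix (c.codeword w j + z) v =
        signal h (c.codeword (replace j u w)) 0 + mix z v := by
      ext t
      simp only [rest, mix, Pi.add_apply, c.signal_replace]
      ring
    simp only [d, this]
  let A (w : (∀ i, Fin (M i)) × (∀ j, Fin (L j))) : Set (Fin n → ℝ) :=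
    {z | (c.dec₁ (signal h (c.codeword w) 0 + z)).2 j ≠ w.2 j}
  have hA : ∀ w, MeasurableSet (A w) := fun w => measurable_noise_set hdec _ _
  let B (u w : (∀ i, Fin (M i)) × (∀ j, Fin (L j))) : Set ((Fin n → ℝ) × (Fin n → ℝ)) :=
    (fun p => mix p.1 p.2) ⁻¹' A (replace j u w)
  have hB : ∀ u w, MeasurableSet (B u w) := fun u w => hmix.measurable (hA _)
  have hBd : ∀ u w v, (fun z => (z, v)) ⁻¹' B u w = {z | d u v (c.codeword w j + z) ≠ w.2 j} := by
    intro u w v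
    ext z
    simp [B, A, hd, replace]
  have hint : ∀ u, ∫⁻ v, ∑ w, noise n {z | d u v (c.codeword w j + z) ≠ w.2 j} ∂noise n =
      ∑ w, noise n (A (replace j u w)) := by
    intro u
    simp only [← hBd]
    rw [lintegral_finsetSum _ fun w _ => measurable_measure_prodMk_right (hB u w)]
    refine Finset.sum_congr rfl fun w _ => ?_
    rw [← Measure.prod_apply_symm (hB u w), hmix.measure_preimage (hA _).nullMeasurableSet]
  -- By `sum_replace`, the right side is the average over `u` of the left side.
  have hu : ∃ u, ∑ w, noise n (A (replace j u w)) ≤ ∑ w, noise n (A w) := by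
    by_contra! hlt
    have := ENNReal.sum_lt_sum_of_nonempty Finset.univ_nonempty fun u _ => hlt u
    rw [sum_replace j fun w => noise n (A w)] at this
    simp at this
  obtain ⟨u, hu⟩ := hu
  obtain ⟨v, hv⟩ := exists_le_lintegral (μ := noise n)
    (f := fun v => ∑ w, noise n {z | d u v (c.codeword w j + z) ≠ w.2 j}) (by
      simp only [← hBd]
      exact (Finset.measurable_sum _ fun w _ =>
        measurable_measure_prodMk_right (hB u w)).aemeasurable)
  rw [hint u] at hv
  refine ⟨d u v, hdec.comp (by fun_prop), ?_⟩
  have hreal := ENNReal.toReal_mono (ENNReal.sum_ne_top.2 fun w _ => measure_ne_top _ _)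
    (hv.trans hu)
  rw [ENNReal.toReal_sum fun w _ => measure_ne_top _ _,
    ENNReal.toReal_sum fun w _ => measure_ne_top _ _] at hreal
  refine hreal.trans (Finset.sum_le_sum fun w _ => measureReal_mono fun z hz hz' => hz ?_)
  rw [hz']

/-- Operating an X channel code as an interference channel code, on sub-collections of the
messages, given by `f` and `g`. -/
lemma exists_iCode (c : XCode P n M L) {h : Others K → ℝ} (hh : ∀ j, h j ^ 2 ≤ 1)
    (hM : ∀ i, 0 < M i) (hL : ∀ j, 0 < L j) {N : Fin K → ℕ} (hN : ∀ i, 0 < N i)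
    (f : ∀ i, Fin (N i) → Fin (M i)) (g : ∀ j : Others K, Fin (N j) → Fin (L j))
    (hf : Function.Injective (f 0)) (hfg : ∀ j : Others K, Function.Injective
      fun m => (f j m, g j m)) :
    ∃ c' : ICode P n N, ∀ i, c'.error h i ≤
      Fintype.card ((∀ i, Fin (M i)) × (∀ j, Fin (L j))) / Fintype.card (∀ i, Fin (N i)) *
        (c.error₁ h + ∑ j, c.error h j) := by
  have : ∀ i, NeZero (M i) := fun i => ⟨(hM i).ne'⟩
  have : ∀ i, NeZero (L i) := fun i => ⟨(hL i).ne'⟩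
  have : ∀ i, NeZero (N i) := fun i => ⟨(hN i).ne'⟩
  -- Injectivity of `E` bounds the total error over merged messages by the total over all X
  -- messages; the changed normalization gives the ratio of cardinalities.
  let E (w : ∀ i, Fin (N i)) : (∀ i, Fin (M i)) × (∀ j, Fin (L j)) :=
    (fun i => f i (w i), fun j => g j (w j))
  have hE : Function.Injective E := fun w w' hw => by
    funext i
    by_cases hi : i = 0
    · subst hi
      exact hf (congrFun (congrArg Prod.fst hw) 0)
    · exact hfg ⟨i, hi⟩ (Prod.ext (congrFun (congrArg Prod.fst hw) i)
        (congrFun (congrArg Prod.snd hw) ⟨i, hi⟩))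
  have hsumE : ∀ F : (∀ i, Fin (M i)) × (∀ j, Fin (L j)) → ℝ, (∀ w, 0 ≤ F w) →
      ∑ w, F (E w) ≤ ∑ w, F w := fun F hF => by
    refine (Finset.sum_map Finset.univ ⟨E, hE⟩ F).symm.trans_le ?_
    exact Finset.sum_le_sum_of_subset_of_nonneg (Finset.subset_univ _) fun w _ _ => hF w
  set D : ℝ := ((Fintype.card ((∀ i, Fin (M i)) × (∀ j, Fin (L j))) : ℕ) : ℝ)
  have hD : 0 < D := by simp only [D]; exact_mod_cast Fintype.card_pos
  have herr₁ : ∑ w, (noise n).real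
      {z | c.dec₁ (signal h (c.codeword w) 0 + z) ≠ (w.1 0, w.2)} = D * c.error₁ h := by
    change _ = D * (_ / D)
    field_simp
  have herr : ∀ k : Others K, ∑ w, (noise n).real
      {z | c.dec k (signal h (c.codeword w) k + z) ≠ w.1 k} = D * c.error h k := fun k => by
    change _ = D * (_ / D)
    field_simp
  have hpos : ∀ k, 0 ≤ c.error h k := fun k => by unfold error; positivity
  have hdec : ∀ i, ∃ d : (Fin n → ℝ) → Fin (N i), Measurable d ∧
      ∑ w : ∀ i, Fin (N i),
        (noise n).real {z | d (signal h (c.codeword (E w)) i + z) ≠ w i} ≤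
      D * (c.error₁ h + ∑ j, c.error h j) := by
    intro i
    by_cases hi : i = 0
    · subst hi
      refine ⟨fun y => Function.invFun (f 0) (c.dec₁ y).1,
        (measurable_of_finite (Function.invFun (f 0))).comp
          (measurable_fst.comp c.measurable_dec₁), ?_⟩
      calc _ ≤ ∑ w, (noise n).real {z | c.dec₁ (signal h (c.codeword (E w)) 0 + z) ≠
              ((E w).1 0, (E w).2)} := by
            refine Finset.sum_le_sum fun w _ => measureReal_mono fun z hz hz' => hz ?_
            change Function.invFun (f 0) (c.dec₁ _).1 = _
            rw [hz']
            exact Function.leftInverse_invFun hf (w 0)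
        _ ≤ D * c.error₁ h := by
            rw [← herr₁]
            exact hsumE (fun w => (noise n).real {z | c.dec₁ (signal h (c.codeword w) 0 + z) ≠
              (w.1 0, w.2)}) fun _ => measureReal_nonneg
        _ ≤ _ := by
            gcongr
            exact le_add_of_nonneg_right (Finset.sum_nonneg fun j _ => hpos j)
    · obtain ⟨j, rfl⟩ : ∃ j : Others K, (j : Fin K) = i := ⟨⟨i, hi⟩, rfl⟩
      obtain ⟨d, hd, hde⟩ := c.exists_cross_decoder hM hL j (hh j)
      have hsig : ∀ w, signal h (c.codeword w) j = c.codeword w j := fun w => by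
        ext t; simp [signal, hi]
      refine ⟨fun y => Function.invFun (fun m => (f j m, g j m)) (c.dec j y, d y),
        (measurable_of_finite (Function.invFun fun m => (f j m, g j m))).comp
          ((c.measurable_dec j).prodMk hd), ?_⟩
      calc _ ≤ ∑ w, ((noise n).real {z | c.dec j (signal h (c.codeword (E w)) j + z) ≠
                (E w).1 j} +
              (noise n).real {z | d (c.codeword (E w) j + z) ≠ (E w).2 j}) := by
            refine Finset.sum_le_sum fun w _ => (measureReal_mono fun z hz => ?_).trans
              (measureReal_union_le _ _)
            by_contra hz'
            simp only [Set.mem_union, Set.mem_ofPred_eq, not_or, not_not] at hz'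
            refine hz ?_
            change Function.invFun (fun m => (f j m, g j m)) (c.dec j _, d _) = _
            rw [hsig] at hz' ⊢
            rw [hz'.1, hz'.2]
            exact Function.leftInverse_invFun (hfg j) (w j)
        _ ≤ ∑ w, ((noise n).real {z | c.dec j (signal h (c.codeword w) j + z) ≠ w.1 j} +
              (noise n).real {z | d (c.codeword w j + z) ≠ w.2 j}) :=
            hsumE (fun w => (noise n).real {z | c.dec j (signal h (c.codeword w) j + z) ≠ w.1 j} +
              (noise n).real {z | d (c.codeword w j + z) ≠ w.2 j}) fun _ => by positivity
        _ ≤ D * c.error h j + D * c.error₁ h := by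
            rw [Finset.sum_add_distrib, herr j]
            gcongr
            exact hde.trans_eq herr₁
        _ ≤ _ := by
            rw [← mul_add, add_comm]
            gcongr
            exact Finset.single_le_sum (fun k _ => hpos k) (Finset.mem_univ j)
  choose d hd hde using hdec
  -- Encoder `i` may use only its own message; the others are set to a dummy `0`, on which codeword
  -- `i` does not depend.
  have henc : ∀ w i, c.codeword (E (Function.update (fun _ => 0) i (w i))) i =
      c.codeword (E w) i := fun w i =>
    c.codeword_congr (by simp [E]) (by simp [E])
  refine ⟨{ enc := fun i m => c.codeword (E (Function.update (fun _ => 0) i m)) i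
            power := fun i m => c.power_codeword _ i
            dec := d
            measurable_dec := hd }, fun i => ?_⟩
  have hN' : (0 : ℝ) < Fintype.card (∀ i, Fin (N i)) := by exact_mod_cast Fintype.card_pos
  rw [ICode.error, div_mul_eq_mul_div]
  refine div_le_div_of_nonneg_right ?_ hN'.le
  simp only [henc]
  exact hde i

end XCode

/-- The rates of the interference channel obtained by merging, at each transmitter, the messages
of the X channel. -/
def XRates.merge {K : ℕ} [NeZero K] (R : XRates K) : Fin K → ℝ :=
  fun i => R.1 i + if hi : i = 0 then 0 else R.2 ⟨i, hi⟩

lemma XRates.merge_zero {K : ℕ} [NeZero K] (R : XRates K) : R.merge 0 = R.1 0 := by simp [merge]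

lemma XRates.merge_others {K : ℕ} [NeZero K] (R : XRates K) (j : Others K) :
    R.merge j = R.1 j + R.2 j := by simp [merge, j.2]

lemma sum_eq_add_sum_others {K : ℕ} [NeZero K] (f : Fin K → ℝ) :
    ∑ i, f i = f 0 + ∑ j : Others K, f j := by
  rw [← Finset.add_sum_erase _ _ (Finset.mem_univ 0),
    Finset.sum_subtype (Finset.univ.erase (0 : Fin K)) (p := fun j => j ≠ 0) (by simp)]

lemma XRates.sum_merge {K : ℕ} [NeZero K] (R : XRates K) :
    ∑ i, R.merge i = R.1 0 + ∑ i : Others K, (R.1 i + R.2 i) := by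
  simp only [sum_eq_add_sum_others, merge_zero, merge_others]

/-- Each rounding up at most doubles a message count, since the rates are nonnegative. The loss is
one factor 2 per message, uniformly in `n`, so errors still tend to 0 after merging. -/
lemma card_messages_le {K : ℕ} [NeZero K] (n : ℕ) {R : XRates K} (h₁ : ∀ i, 0 ≤ R.1 i)
    (h₂ : ∀ j, 0 ≤ R.2 j) :
    (Fintype.card ((∀ i, Fin (numMessages n (R.1 i))) × (∀ j, Fin (numMessages n (R.2 j)))) : ℝ) ≤
      2 ^ (K + Fintype.card (Others K)) *
        Fintype.card (∀ i, Fin (numMessages n (R.merge i))) := by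
  have hle : ∏ i, (2 : ℝ) ^ ((n : ℝ) * R.merge i) ≤
      Fintype.card (∀ i, Fin (numMessages n (R.merge i))) := by
    rw [Fintype.card_pi, Nat.cast_prod]
    refine Finset.prod_le_prod (fun i _ => by positivity) fun i _ => ?_
    rw [Fintype.card_fin]
    exact rpow_le_numMessages n _
  refine le_trans ?_ (mul_le_mul_of_nonneg_left hle (by positivity))
  have hprod : ∀ {ι : Type} [Fintype ι] (r : ι → ℝ),
      ∏ i, (2 : ℝ) ^ ((n : ℝ) * r i) = (2 : ℝ) ^ ((n : ℝ) * ∑ i, r i) := fun r => by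
    rw [Finset.mul_sum, Real.rpow_sum_of_pos (by norm_num)]
  have hcard : ∀ {ι : Type} [Fintype ι] [DecidableEq ι] (r : ι → ℝ), (∀ i, 0 ≤ r i) →
      (Fintype.card (∀ i, Fin (numMessages n (r i))) : ℝ) ≤
        2 ^ Fintype.card ι * (2 : ℝ) ^ ((n : ℝ) * ∑ i, r i) := fun r hr => by
    rw [Fintype.card_pi, Nat.cast_prod, ← hprod, ← Finset.card_univ, ← Finset.prod_const,
      ← Finset.prod_mul_distrib]
    refine Finset.prod_le_prod (fun i _ => by positivity) fun i _ => ?_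
    rw [Fintype.card_fin]
    exact numMessages_le_two_mul n (hr i)
  rw [Fintype.card_prod, Nat.cast_mul, hprod, R.sum_merge]
  refine (mul_le_mul (hcard _ h₁) (hcard _ h₂) (by positivity) (by positivity)).trans_eq ?_
  rw [Fintype.card_fin, sum_eq_add_sum_others R.1, Finset.sum_add_distrib, pow_add, ← add_assoc,
    mul_add (n : ℝ) _ (∑ j, R.2 j), Real.rpow_add (by norm_num)]
  ring

lemma XAchievable.merge {K : ℕ} [NeZero K] {h : Others K → ℝ} {P : Fin K → ℝ} {R : XRates K}
    (hR : XAchievable h P R) (hh : ∀ j, h j ^ 2 ≤ 1) : IAchievable h P R.merge := by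
  obtain ⟨h₁, h₂, c, hc₁, hc⟩ := hR
  refine ⟨fun i => add_nonneg (h₁ i) (by split_ifs; exacts [le_rfl, h₂ _]), ?_⟩
  have hcode : ∀ n, ∃ c' : ICode P n (fun i => numMessages n (R.merge i)), ∀ i, c'.error h i ≤
      2 ^ (K + Fintype.card (Others K)) * ((c n).error₁ h + ∑ j, (c n).error h j) := by
    intro n
    have hpos := one_le_numMessages n
    have : ∀ r, NeZero (numMessages n r) := fun r => ⟨Nat.one_le_iff_ne_zero.1 (hpos r)⟩
    have hemb : ∀ j : Others K, ∃ e : Fin (numMessages n (R.merge j)) →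
        Fin (numMessages n (R.1 j)) × Fin (numMessages n (R.2 j)), Function.Injective e := by
      intro j
      obtain ⟨e⟩ := Function.Embedding.nonempty_of_card_le
        (α := Fin (numMessages n (R.merge j)))
        (β := Fin (numMessages n (R.1 j)) × Fin (numMessages n (R.2 j))) (by
          simpa [R.merge_others] using numMessages_add_le n (R.1 j) (R.2 j))
      exact ⟨e, e.injective⟩
    choose e he using hemb
    -- User 1 has no cross message, so its message set is unchanged up to a cast; the other users
    -- take the first component of `e`.
    have hemb₀ : ∃ f : ∀ i, Fin (numMessages n (R.merge i)) → Fin (numMessages n (R.1 i)),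
        Function.Injective (f 0) ∧ ∀ j : Others K, f j = fun m => (e j m).1 := by
      refine ⟨fun i => if hi : i = 0 then Fin.cast (by rw [hi, R.merge_zero]) else
        fun m => (e ⟨i, hi⟩ m).1, ?_, fun j => by simp [j.2]⟩
      simpa using Fin.cast_injective _
    obtain ⟨f, hf, hfe⟩ := hemb₀
    obtain ⟨c', hc'⟩ := (c n).exists_iCode hh (fun i => hpos _) (fun j => hpos _)
      (N := fun i => numMessages n (R.merge i)) (fun i => hpos _) f (fun j m => (e j m).2) hf
      fun j => by simpa [hfe] using he j
    refine ⟨c', fun i => (hc' i).trans ?_⟩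
    have hnn : 0 ≤ (c n).error₁ h + ∑ j, (c n).error h j := by
      unfold XCode.error₁ XCode.error; positivity
    refine mul_le_mul_of_nonneg_right ?_ hnn
    rw [div_le_iff₀ (by exact_mod_cast Fintype.card_pos)]
    exact card_messages_le n h₁ h₂
  choose c' hc' using hcode
  refine ⟨c', fun k => ?_⟩
  have hlim : Tendsto (fun n => 2 ^ (K + Fintype.card (Others K)) *
      ((c n).error₁ h + ∑ j, (c n).error h j)) atTop (𝓝 0) := by
    simpa using (hc₁.add (tendsto_finsetSum Finset.univ fun j _ => hc j)).const_mul
      ((2 : ℝ) ^ (K + Fintype.card (Others K)))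
  exact squeeze_zero (fun n => by unfold ICode.error; positivity) (fun n => hc' n k) hlim

/-! ### From the interference channel to the X channel -/

/-- An interference channel code is an X channel code with trivial cross messages. -/
def ICode.toXCode {K n : ℕ} [NeZero K] {P : Fin K → ℝ} {M : Fin K → ℕ} (c : ICode P n M)
    {L : Others K → ℕ} (hL : ∀ j, 0 < L j) : XCode P n M L where
  enc₁ := c.enc 0
  enc j w := c.enc j w.1
  power₁ := c.power 0
  power j w := c.power j w.1
  dec₁ y := (c.dec 0 y, fun j => ⟨0, hL j⟩)
  dec j := c.dec j
  measurable_dec₁ := (c.measurable_dec 0).prodMk measurable_const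
  measurable_dec j := c.measurable_dec j

section toXCode

variable {K n : ℕ} [NeZero K] {P : Fin K → ℝ} {M : Fin K → ℕ} (c : ICode P n M)
  {L : Others K → ℕ}

lemma ICode.codeword_toXCode (hL' : ∀ j, 0 < L j) (w : (∀ i, Fin (M i)) × (∀ j, Fin (L j))) :
    (c.toXCode hL').codeword w = fun i => c.enc i (w.1 i) := by
  funext i
  unfold XCode.codeword
  split_ifs with hi
  · subst hi; rfl
  · rfl

lemma sum_div_card_of_eq_one (hL : ∀ j, L j = 1) (F : (∀ i, Fin (M i)) → ℝ) :
    (∑ w : (∀ i, Fin (M i)) × (∀ j, Fin (L j)), F w.1) /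
        Fintype.card ((∀ i, Fin (M i)) × (∀ j, Fin (L j))) =
      (∑ w, F w) / Fintype.card (∀ i, Fin (M i)) := by
  have hcard : Fintype.card (∀ j, Fin (L j)) = 1 := by simp [hL]
  rw [Fintype.sum_prod_type, Fintype.card_prod, hcard, mul_one]
  simp only [Finset.sum_const, Finset.card_univ, hcard, one_smul]

lemma ICode.error₁_toXCode (hL : ∀ j, L j = 1) (hL' : ∀ j, 0 < L j) (h : Others K → ℝ) :
    (c.toXCode hL').error₁ h = c.error h 0 := by
  have : ∀ j, Subsingleton (Fin (L j)) := fun j => by rw [hL j]; infer_instance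
  rw [XCode.error₁, ICode.error, ← sum_div_card_of_eq_one hL]
  simp only [codeword_toXCode]
  congr 1
  refine Finset.sum_congr rfl fun w _ => ?_
  congr 1
  ext z
  exact not_congr (Prod.ext_iff.trans (and_iff_left (Subsingleton.elim _ _)))

lemma ICode.error_toXCode (hL : ∀ j, L j = 1) (hL' : ∀ j, 0 < L j) (h : Others K → ℝ) (k : Others K) :
    (c.toXCode hL').error h k = c.error h k := by
  rw [XCode.error, ICode.error, ← sum_div_card_of_eq_one hL]
  simp only [codeword_toXCode]
  rfl

end toXCode

lemma IAchievable.xAchievable {K : ℕ} [NeZero K] {h : Others K → ℝ} {P : Fin K → ℝ}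
    {R : Fin K → ℝ} (hR : IAchievable h P R) : XAchievable h P (R, 0) := by
  obtain ⟨h₁, c, hc⟩ := hR
  refine ⟨h₁, fun _ => le_rfl,
    fun n => (c n).toXCode fun _ => one_le_numMessages n _, ?_, fun k => ?_⟩
  · simpa only [(c _).error₁_toXCode (fun _ => numMessages_zero _) _ h] using hc 0
  · simpa only [(c _).error_toXCode (fun _ => numMessages_zero _) _ h] using hc k

/-- Merging and padding with zero cross rates are continuous and preserve the sum-rate, so they pass
to closures. Equality as sets also transfers the maximum, with no separate compactness argument for
the X channel. -/
lemma xSumRates_eq_iSumRates {K : ℕ} [NeZero K] {h : Others K → ℝ} (P : Fin K → ℝ)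
    (hh : ∀ j, h j ^ 2 ≤ 1) : xSumRates h P = iSumRates h P := by
  apply Set.Subset.antisymm
  · rintro _ ⟨R, hR, rfl⟩
    have hcont : Continuous (XRates.merge : XRates K → Fin K → ℝ) := by
      refine continuous_pi fun i => ?_
      unfold XRates.merge
      split_ifs <;> fun_prop
    exact ⟨R.merge, map_mem_closure hcont hR fun R hR => hR.merge hh, R.sum_merge⟩
  · rintro _ ⟨R, hR, rfl⟩
    refine ⟨(R, 0), map_mem_closure (f := fun R : Fin K → ℝ => ((R, 0) : XRates K))
      (by fun_prop) hR fun R hR => IAchievable.xAchievable hR, ?_⟩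
    simp [sum_eq_add_sum_others R]

end ManyToOne

end

theorem theorem5 (K : ℕ) [NeZero K] (h : ManyToOne.Others K → ℝ) (P : Fin K → ℝ)
    (hP : ∀ i, 0 ≤ P i) (hh : ∀ i : ManyToOne.Others K, h i ^ 2 ≤ 1) :
    IsGreatest (ManyToOne.xSumRates h P) (ManyToOne.xSumCapacity h P) ∧
    IsGreatest (ManyToOne.iSumRates h P) (ManyToOne.iSumCapacity h P) ∧
    ManyToOne.xSumCapacity h P = ManyToOne.iSumCapacity h P := by
  have hI := ManyToOne.isGreatest_iSumCapacity hP hh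
  have hsets := ManyToOne.xSumRates_eq_iSumRates P hh
  have hcap : ManyToOne.xSumCapacity h P = ManyToOne.iSumCapacity h P :=
    congrArg sSup hsets
  exact ⟨by rw [hsets, hcap]; exact hI, hI, hcap⟩
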